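/- **Setting.** Let $n\ge 3$ and use the upper half-space model $\{(p,h): p\in\mathbb R^{n-1},\,h>0\}$ of hyperbolic space $\mathbf H^n$. A unit tangent vector $v$ of $\mathbf H^n$ whose directed geodesic runs from $x$ to $y$, with $x\neq y$ in $\mathbb R^{n-1}$, is recorded by $(x,y,t)$, where $t\in\mathbb R$ is the signed hyperbolic distance of the base point of $v$ from the highest point of that geodesic; the base point is $$\Bigl(\tfrac{x+y}{2}+\tfrac{\tanh t}{2}(y-x),\ \tfrac{|x-y|}{2\cosh t}\Bigr).$$ In these coordinates let $\Omega$ be the measure $$d\Omega=\frac{2\,dV(x)\,dV(y)\,dt}{|x-y|^{2n-2}},$$ where $dV$ is Lebesgue measure on $\mathbb R^{n-1}$. For $a>1$ put $D=\{x\in\mathbb R^{n-1}:|x|\le 1\}$ and $D_a=\{x\in\mathbb R^{n-1}:|x|\ge a\}$, and let $H=\{|p|^2+h^2<1\}$ and $H_a=\{|p|^2+h^2>a^2\}$ be the corresponding open half-spaces of $\mathbf H^n$. Let $Q_a$ be the set of unit tangent vectors $(x,y,t)$ with base point in $\mathbf H^n\setminus(H\cup H_a)$ and with one of $x,y$ in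 $D$ and the other in $D_a$. For $l>0$ define $$F_n(l)=\frac{\Omega(Q_{e^l})}{\mathrm{Vol}(\mathbf S^{n-1})},$$ where $\mathrm{Vol}(\mathbf S^{n-1})$ is the surface volume of the unit sphere of $\mathbb R^n$. Let $P_m(x)=\sum_{k=1}^m x^k/k$, so that $P_m(1)$ is the $m$-th harmonic number. **Lemma.** For every $n\ge 3$, $\Omega(Q_{e^l})$ is finite and positive for all $l>0$, so that $F_n:(0,\infty)\to(0,\infty)$, and: 1. There is a constant $C_n>0$ such that $F_n(l)\le \dfrac{C_n}{(e^l-1)^{n-2}}$ for all $l>0$. 2. $F_n$ is continuous and (strictly) monotonically decreasing on $(0,\infty)$. 3. $$\lim_{l\to 0^+} l^{n-2}F_n(l)=K_n:=\frac{2\pi^{\frac{n-3}{2}}\,P_{n-2}(1)\,\Gamma(\frac n2+1)\,\Gamma(\frac n2-1)}{n\,\Gamma(\frac{n+1}{2})\,\Gamma(n-1)},\qquad K_n>0.$$ 4. $$\lim_{l\to\infty}\frac{e^{(n-1)l}}{l}\,F_n(l)=\frac{(n-2)\,\pi^{\frac{n-2}{2}}\,\Gamma(\frac n2-1)}{\Gamma(\frac{n+1}{2})^2}.$$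 -/

import Mathlib

open MeasureTheory

noncomputable section

namespace Orthospectrum

/-- The finite part `ℝ^{n-1}` of the sphere at infinity of hyperbolic `n`-space, in the upper
half-space model. -/
abbrev Boundary (n : ℕ) : Type := EuclideanSpace ℝ (Fin (n - 1))

/-- Points of the upper half-space model are pairs (horizontal part in `ℝ^{n-1}`, height). -/
abbrev HalfSpaceModel (n : ℕ) : Type := Boundary n × ℝ

/-- Geodesic coordinates `(x, y, t)` on the unit tangent bundle of hyperbolic `n`-space: for
`x ≠ y`, the triple stands for the unit vector tangent to the geodesic directed from `x` to `y`,
based at signed hyperbolic distance `t` from the highest point of that geodesic.  The diagonal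
`x = y`, which represents no vector, is a null set. -/
abbrev TangentCoord (n : ℕ) : Type := Boundary n × Boundary n × ℝ

/-- The base point of the unit tangent vector `(x, y, t)`: with `R = |x - y| / 2`, the geodesic from
`x` to `y` is the semicircle with centre `(x + y) / 2` and radius `R` orthogonal to the boundary,
which has the unit speed parametrization
`t ↦ ((x + y) / 2 + R tanh t • (y - x) / |y - x|, R / cosh t)`. -/
def basePoint {n : ℕ} (q : TangentCoord n) : HalfSpaceModel n :=
  (midpoint ℝ q.1 q.2.1 + (Real.tanh q.2.2 / 2) • (q.2.1 - q.1),
    ‖q.2.1 - q.1‖ / (2 * Real.cosh q.2.2))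

/-- The volume measure `dΩ = 2 dV(x) dV(y) dt / |x - y|^{2n-2}` in geodesic coordinates. -/
def Omega (n : ℕ) : Measure (TangentCoord n) :=
  (volume : Measure (TangentCoord n)).withDensity
    fun q => ENNReal.ofReal (2 / ‖q.1 - q.2.1‖ ^ (2 * n - 2))

/-- `D = {x ∈ ℝ^{n-1} : |x| ≤ 1}`. -/
def D (n : ℕ) : Set (Boundary n) := {x | ‖x‖ ≤ 1}

/-- `D_a = {x ∈ ℝ^{n-1} : |x| ≥ a}`. -/
def Dout (n : ℕ) (a : ℝ) : Set (Boundary n) := {x | a ≤ ‖x‖}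

/-- The open hyperbolic half-space `H` over `D`. -/
def H (n : ℕ) : Set (HalfSpaceModel n) := {p | ‖p.1‖ ^ 2 + p.2 ^ 2 < 1}

/-- The open hyperbolic half-space `H_a` over `D_a`. -/
def Hout (n : ℕ) (a : ℝ) : Set (HalfSpaceModel n) := {p | a ^ 2 < ‖p.1‖ ^ 2 + p.2 ^ 2}

/-- `Q_a`: the unit tangent vectors based outside `H ∪ H_a` and tangent to a geodesic one of whose
endpoints is in `D` and the other in `D_a`. -/
def Q (n : ℕ) (a : ℝ) : Set (TangentCoord n) :=
  {q | ((q.1 ∈ D n ∧ q.2.1 ∈ Dout n a) ∨ (q.1 ∈ Dout n a ∧ q.2.1 ∈ D n)) ∧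
    basePoint q ∉ H n ∪ Hout n a}

/-- The surface volume of the unit sphere of `ℝ^n`, i.e. `Vol(S^{n-1})`. -/
def volUnitSphere (n : ℕ) : ℝ :=
  (volume : Measure (EuclideanSpace ℝ (Fin n))).toSphere.real Set.univ

/-- `F_n(l) = Ω(Q_a) / Vol(S^{n-1})` with `a = e^l`. -/
def F (n : ℕ) (l : ℝ) : ℝ := (Omega n).real (Q n (Real.exp l)) / volUnitSphere n

/-- The polynomial `P_m(x) = ∑_{k=1}^m x^k / k`. -/
def P (m : ℕ) (x : ℝ) : ℝ := ∑ k ∈ Finset.Icc 1 m, x ^ k / (k : ℝ)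

/-- The limit of `l^{n-2} F_n(l)` at `0`. -/
def K (n : ℕ) : ℝ :=
  2 * Real.pi ^ (((n : ℝ) - 3) / 2) * P (n - 2) 1 * Real.Gamma ((n : ℝ) / 2 + 1)
      * Real.Gamma ((n : ℝ) / 2 - 1)
    / (n * Real.Gamma (((n : ℝ) + 1) / 2) * Real.Gamma ((n : ℝ) - 1))

end Orthospectrum

end

noncomputable section

namespace Orthospectrum

/-! ### Polar coordinates and inversions -/

section Volume

open Set Metric Module EuclideanGeometry
open scoped ENNReal RealInnerProductSpace

/-! The volume of `Q` reduces to a one-dimensional integral, from which every claim is read off.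
Write `n = m + 3`, so the boundary has dimension `d = m + 2`. Along the geodesic from `x` to `y`,
the squared Euclidean norm of the base point depends only on `‖x‖`, `‖y‖` and `t`
(`norm_sq_basePoint`). The time spent between the half-spaces is therefore explicit, and it is a
function of `x` plus a function of `y` (`volume_Qfwd_slice`). In each summand the kernel `‖x - y‖ ^
(-2 d)` can be integrated over the other variable: it is the Jacobian of an inversion, so the
integral is the volume of a ball (`lintegral_oppositeSide`). Two radial integrals remain, and
rational substitutions carry both to the same weight on `(0, 1)`.

With `a = e^l` and `J = logIntegral m` this gives `F = Fconst m * e^{-l} J(l) / (2 sinh l)^(m+1)`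
(`F_eq`). The upper bound comes from `J(l) ≤ l + 1 ≤ e^l`, and continuity from dominated
convergence. Monotonicity holds because `e^{-l} J(l)` is antitone after rescaling the variable
(`antitoneOn_exp_neg_mul_logIntegral`) while `sinh` strictly increases. The two limits come from
`J(0)`, a harmonic number over `m + 1`, and from `J(l) / l → 2 / (m + 2)`; Gamma identities then
match the constants. -/

/-- Polar coordinates for the Lebesgue integral of a radial function. -/
theorem lintegral_fun_norm_addHaar {E : Type*} [NormedAddCommGroup E] [NormedSpace ℝ E]
    [FiniteDimensional ℝ E] [Nontrivial E] [MeasurableSpace E] [BorelSpace E] (μ : Measure E)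
    [μ.IsAddHaarMeasure] {f : ℝ → ℝ≥0∞} (hf : Measurable f) :
    ∫⁻ x, f ‖x‖ ∂μ = finrank ℝ E * μ (ball 0 1) *
      ∫⁻ r in Ioi (0 : ℝ), ENNReal.ofReal (r ^ (finrank ℝ E - 1)) * f r :=
  calc
    ∫⁻ x, f ‖x‖ ∂μ = ∫⁻ x : ({(0)}ᶜ : Set E), f ‖x.1‖ ∂(μ.comap (↑)) := by
      rw [lintegral_subtype_comap (measurableSet_singleton _).compl fun x ↦ f ‖x‖,
        restrict_compl_singleton]
    _ = ∫⁻ x, f x.2 ∂μ.toSphere.prod (.volumeIoiPow (finrank ℝ E - 1)) := by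
      have := μ.measurePreserving_homeomorphUnitSphereProd.lintegral_comp_emb
        (Homeomorph.measurableEmbedding _) (f ∘ Subtype.val ∘ Prod.snd)
      simpa using this
    _ = μ.toSphere univ * ∫⁻ x : Ioi (0 : ℝ), f x ∂.volumeIoiPow (finrank ℝ E - 1) := by
      rw [lintegral_prod _ (by fun_prop)]
      simp only [lintegral_const, mul_comm]
    _ = _ := by
      rw [μ.toSphere_apply_univ, Measure.volumeIoiPow,
        lintegral_withDensity_eq_lintegral_mul _ (by fun_prop) (by fun_prop),
        ← lintegral_subtype_comap measurableSet_Ioi]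
      rfl

section Inversion

variable {E : Type*} [NormedAddCommGroup E]

/-- The side of the sphere of radius `R` about the origin that does not contain `c`. -/
def oppositeSide (c : E) (R : ℝ) : Set E := {y | (‖y‖ ^ 2 - R ^ 2) * (‖c‖ ^ 2 - R ^ 2) < 0}

theorem notMem_oppositeSide (c : E) (R : ℝ) : c ∉ oppositeSide c R := by
  simp only [oppositeSide, mem_ofPred_eq, not_lt]
  exact mul_self_nonneg _

theorem measurableSet_oppositeSide [MeasurableSpace E] [BorelSpace E] (c : E) (R : ℝ) :
    MeasurableSet (oppositeSide c R) :=
  (isOpen_lt (by fun_prop) continuous_const).measurableSet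

variable [InnerProductSpace ℝ E]

/-- Put `z = c + w` and `k = R² - ‖c‖²`. After clearing denominators, membership on either side
becomes `k²‖w‖² - (2⟪c, w⟫ + 1) k < 0`. The point `c` is removed because `inversion` fixes its
centre, which would geometrically be the image of infinity. -/
theorem inversion_image_oppositeSide {c : E} {R : ℝ} (hR : 0 < R) (hc : ‖c‖ ≠ R) :
    inversion c 1 '' oppositeSide c R =
      ball (c + (R ^ 2 - ‖c‖ ^ 2)⁻¹ • c) (R / |‖c‖ ^ 2 - R ^ 2|) \ {c} := by
  have hinv := inversion_involutive c (one_ne_zero : (1 : ℝ) ≠ 0)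
  rw [image_eq_preimage_of_inverse hinv.leftInverse hinv.rightInverse]
  have hk : R ^ 2 - ‖c‖ ^ 2 ≠ 0 := by
    intro h
    exact hc ((pow_left_inj₀ (norm_nonneg c) hR.le two_ne_zero).1 (by linarith))
  ext z
  by_cases hz : z = c
  · subst hz
    simpa using notMem_oppositeSide z R
  obtain ⟨w, rfl⟩ : ∃ w, z = c + w := ⟨z - c, by abel⟩
  have hw : w ≠ 0 := by simpa using hz
  have hW : 0 < ‖w‖ ^ 2 := by positivity
  have h1 : ‖inversion c 1 (c + w)‖ ^ 2 =
      ‖c‖ ^ 2 + (2 * ⟪c, w⟫ + 1) / ‖w‖ ^ 2 := by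
    have : inversion c 1 (c + w) = c + (1 / ‖w‖ ^ 2) • w := by
      simp [inversion, dist_eq_norm, add_comm]
    rw [this, norm_add_sq_real, norm_smul, inner_smul_right]
    simp only [Real.norm_eq_abs, mul_pow, sq_abs]
    field_simp
    ring
  have h2 : dist (c + w) (c + (R ^ 2 - ‖c‖ ^ 2)⁻¹ • c) ^ 2 =
      ‖w‖ ^ 2 - 2 * ⟪c, w⟫ / (R ^ 2 - ‖c‖ ^ 2) + ‖c‖ ^ 2 / (R ^ 2 - ‖c‖ ^ 2) ^ 2 := by
    rw [dist_add_left, dist_eq_norm, norm_sub_sq_real, norm_smul, inner_smul_right,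
      real_inner_comm]
    simp only [Real.norm_eq_abs, mul_pow, sq_abs]
    field_simp
  simp only [mem_preimage, oppositeSide, mem_ofPred_eq, mem_sdiff, mem_ball, mem_singleton_iff, hz,
    not_false_eq_true, and_true]
  rw [← pow_lt_pow_iff_left₀ dist_nonneg (by positivity) two_ne_zero, h1, h2, div_pow, sq_abs]
  have hk2 : 0 < (R ^ 2 - ‖c‖ ^ 2) ^ 2 := by positivity
  have e1 : (‖c‖ ^ 2 + (2 * ⟪c, w⟫ + 1) / ‖w‖ ^ 2 - R ^ 2) * (‖c‖ ^ 2 - R ^ 2) =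
      ((R ^ 2 - ‖c‖ ^ 2) ^ 2 * ‖w‖ ^ 2 - (2 * ⟪c, w⟫ + 1) * (R ^ 2 - ‖c‖ ^ 2)) / ‖w‖ ^ 2 := by
    field_simp
    ring
  have e2 : ‖w‖ ^ 2 - 2 * ⟪c, w⟫ / (R ^ 2 - ‖c‖ ^ 2) + ‖c‖ ^ 2 / (R ^ 2 - ‖c‖ ^ 2) ^ 2 -
      R ^ 2 / (‖c‖ ^ 2 - R ^ 2) ^ 2 =
      ((R ^ 2 - ‖c‖ ^ 2) ^ 2 * ‖w‖ ^ 2 - (2 * ⟪c, w⟫ + 1) * (R ^ 2 - ‖c‖ ^ 2)) /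
        (R ^ 2 - ‖c‖ ^ 2) ^ 2 := by
    rw [show (‖c‖ ^ 2 - R ^ 2) ^ 2 = (R ^ 2 - ‖c‖ ^ 2) ^ 2 by ring]
    field_simp
    ring
  rw [e1, ← sub_neg (b := R ^ 2 / _), e2, div_neg_iff, div_neg_iff]
  simp [hW, hk2, hW.not_gt, hk2.not_gt]

variable [FiniteDimensional ℝ E]

/-- The derivative of an inversion is a nonnegative multiple of a reflection, so only the scaling
factor enters the Jacobian. -/
theorem abs_det_smul_reflection (K : Submodule ℝ E) (s : ℝ) (hs : 0 ≤ s) :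
    |(s • (K.reflection : E →L[ℝ] E)).det| = s ^ finrank ℝ E := by
  have h : ((s • (K.reflection : E →L[ℝ] E) : E →L[ℝ] E) : E →ₗ[ℝ] E) =
      s • K.reflection.toLinearMap := rfl
  rw [ContinuousLinearMap.det, h, LinearMap.det_smul, Submodule.det_reflection, abs_mul,
    abs_pow, abs_pow, abs_neg, abs_one, one_pow, mul_one, abs_of_nonneg hs]

/-- The integral of `‖c - y‖ ^ (-2 d)` over the side of a sphere not containing `c` is the volume
of the ball which is the image of that side under the inversion in the unit sphere about `c`. -/
theorem lintegral_oppositeSide [MeasurableSpace E] [BorelSpace E] [Nontrivial E] {d : ℕ} (hd : finrank ℝ E = d)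
    (μ : Measure E) [μ.IsAddHaarMeasure] {c : E} {R : ℝ} (hR : 0 < R) (hc : ‖c‖ ≠ R) :
    ∫⁻ y in oppositeSide c R, ENNReal.ofReal (1 / ‖c - y‖ ^ (2 * d)) ∂μ =
      ENNReal.ofReal ((R / |‖c‖ ^ 2 - R ^ 2|) ^ d) * μ (ball 0 1) := by
  have hne : ∀ y ∈ oppositeSide c R, y ≠ c := by
    rintro y hy rfl
    exact notMem_oppositeSide y R hy
  have key := lintegral_abs_det_fderiv_eq_addHaar_image μ (measurableSet_oppositeSide c R)
    (fun y hy => (hasFDerivAt_inversion (R := 1) (hne y hy)).hasFDerivWithinAt)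
    (inversion_injective c one_ne_zero).injOn
  rw [inversion_image_oppositeSide hR hc, measure_sdiff_null (measure_singleton _),
    Measure.addHaar_ball _ _ (by positivity), hd] at key
  rw [← key]
  refine setLIntegral_congr_fun (measurableSet_oppositeSide c R) fun y hy => ?_
  rw [abs_det_smul_reflection _ _ (by positivity), hd, dist_eq_norm, norm_sub_rev, pow_mul,
    ← pow_mul, ← pow_mul, div_pow, one_pow]

end Inversion

/-! ### Time spent by a geodesic between the half-spaces -/

/-- Since `1 / cosh² = 1 - tanh²`, the inner products `⟪x, y⟫` from the horizontal part and from the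
height cancel. -/
theorem norm_sq_basePoint {n : ℕ} (q : TangentCoord n) :
    ‖(basePoint q).1‖ ^ 2 + (basePoint q).2 ^ 2 =
      (‖q.1‖ ^ 2 + ‖q.2.1‖ ^ 2) / 2 + Real.tanh q.2.2 * (‖q.2.1‖ ^ 2 - ‖q.1‖ ^ 2) / 2 := by
  obtain ⟨x, y, t⟩ := q
  have h1 : ‖midpoint ℝ x y + (Real.tanh t / 2) • (y - x)‖ ^ 2 =
      (‖x‖ ^ 2 + 2 * ⟪x, y⟫ + ‖y‖ ^ 2) / 4 + Real.tanh t * (‖y‖ ^ 2 - ‖x‖ ^ 2) / 2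
        + Real.tanh t ^ 2 * (‖x‖ ^ 2 - 2 * ⟪x, y⟫ + ‖y‖ ^ 2) / 4 := by
    rw [midpoint_eq_smul_add, norm_add_sq_real, norm_smul, norm_smul, inner_smul_left,
      inner_smul_right, mul_pow, mul_pow, norm_add_sq_real, norm_sub_sq_real, inner_add_left,
      inner_sub_right, inner_sub_right, real_inner_self_eq_norm_sq, real_inner_self_eq_norm_sq,
      real_inner_comm x y]
    simp only [invOf_eq_inv, Real.norm_eq_abs, sq_abs, conj_trivial]
    ring
  have h2 : (‖y - x‖ / (2 * Real.cosh t)) ^ 2 =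
      (1 - Real.tanh t ^ 2) * (‖x‖ ^ 2 - 2 * ⟪x, y⟫ + ‖y‖ ^ 2) / 4 := by
    have hc := Real.cosh_pos t
    rw [div_pow, norm_sub_sq_real, Real.tanh_eq_sinh_div_cosh, real_inner_comm]
    field_simp
    rw [Real.cosh_sq]
    ring
  simp only [basePoint]
  rw [h1, h2]
  ring

/-- The vectors of `Q n a` whose geodesic starts in `D n`. -/
def Qfwd (n : ℕ) (a : ℝ) : Set (TangentCoord n) :=
  {q | (q.1 ∈ D n ∧ q.2.1 ∈ Dout n a) ∧ basePoint q ∉ H n ∪ Hout n a}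

/-- Reversal of the direction of tangent vectors. -/
def flip {n : ℕ} (q : TangentCoord n) : TangentCoord n := (q.2.1, q.1, -q.2.2)

theorem basePoint_notMem_iff {n : ℕ} {a : ℝ} (q : TangentCoord n) :
    basePoint q ∉ H n ∪ Hout n a ↔
      1 ≤ ‖(basePoint q).1‖ ^ 2 + (basePoint q).2 ^ 2 ∧
        ‖(basePoint q).1‖ ^ 2 + (basePoint q).2 ^ 2 ≤ a ^ 2 := by
  simp [H, Hout]

theorem basePoint_flip_notMem_iff {n : ℕ} {a : ℝ} (q : TangentCoord n) :
    basePoint (flip q) ∉ H n ∪ Hout n a ↔ basePoint q ∉ H n ∪ Hout n a := by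
  rw [basePoint_notMem_iff, basePoint_notMem_iff, norm_sq_basePoint, norm_sq_basePoint]
  have : (‖(flip q).1‖ ^ 2 + ‖(flip q).2.1‖ ^ 2) / 2 +
      Real.tanh (flip q).2.2 * (‖(flip q).2.1‖ ^ 2 - ‖(flip q).1‖ ^ 2) / 2 =
      (‖q.1‖ ^ 2 + ‖q.2.1‖ ^ 2) / 2 + Real.tanh q.2.2 * (‖q.2.1‖ ^ 2 - ‖q.1‖ ^ 2) / 2 := by
    simp only [flip, Real.tanh_neg]
    ring
  rw [this]

theorem Q_eq_union (n : ℕ) (a : ℝ) : Q n a = Qfwd n a ∪ flip ⁻¹' Qfwd n a := by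
  ext q
  simp only [Q, Qfwd, mem_union, mem_preimage, mem_ofPred_eq]
  rw [← mem_union, ← mem_union, basePoint_flip_notMem_iff, flip]
  tauto

theorem measurableSet_Qfwd (n : ℕ) (a : ℝ) : MeasurableSet (Qfwd n a) := by
  have : Qfwd n a = {q | ‖q.1‖ ≤ 1} ∩ {q | a ≤ ‖q.2.1‖} ∩
      {q | 1 ≤ (‖q.1‖ ^ 2 + ‖q.2.1‖ ^ 2) / 2 +
        Real.sinh q.2.2 / Real.cosh q.2.2 * (‖q.2.1‖ ^ 2 - ‖q.1‖ ^ 2) / 2} ∩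
      {q | (‖q.1‖ ^ 2 + ‖q.2.1‖ ^ 2) / 2 +
        Real.sinh q.2.2 / Real.cosh q.2.2 * (‖q.2.1‖ ^ 2 - ‖q.1‖ ^ 2) / 2 ≤ a ^ 2} := by
    ext q
    simp only [Qfwd, basePoint_notMem_iff, norm_sq_basePoint, D, Dout, mem_ofPred_eq, mem_inter_iff,
      Real.tanh_eq_sinh_div_cosh]
    tauto
  rw [this]
  refine (((measurableSet_le ?_ ?_).inter (measurableSet_le ?_ ?_)).inter
    (measurableSet_le ?_ ?_)).inter (measurableSet_le ?_ ?_) <;> fun_prop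

theorem measurePreserving_flip (n : ℕ) :
    MeasurePreserving (flip : TangentCoord n → TangentCoord n) volume volume := by
  have h1 := (volume_preserving_prodAssoc (α₁ := Boundary n) (β₁ := Boundary n) (γ₁ := ℝ))
  have h2 : MeasurePreserving (Prod.map Prod.swap Neg.neg :
      (Boundary n × Boundary n) × ℝ → (Boundary n × Boundary n) × ℝ) volume volume :=
    (Measure.measurePreserving_swap (μ := (volume : Measure (Boundary n)))
      (ν := (volume : Measure (Boundary n)))).prod (Measure.measurePreserving_neg volume)
  exact (h1.comp h2).comp (h1.symm MeasurableEquiv.prodAssoc)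

theorem measurable_density (n : ℕ) :
    Measurable fun q : TangentCoord n => ENNReal.ofReal (2 / ‖q.1 - q.2.1‖ ^ (2 * n - 2)) := by
  fun_prop

theorem Omega_flip_preimage (n : ℕ) {S : Set (TangentCoord n)} (hS : MeasurableSet S) :
    Omega n (flip ⁻¹' S) = Omega n S := by
  have hm := measurePreserving_flip n
  rw [Omega, withDensity_apply _ hS, withDensity_apply _ (hm.measurable hS),
    ← hm.setLIntegral_comp_preimage hS (measurable_density n)]
  simp only [flip, norm_sub_rev]

theorem Omega_Q {n : ℕ} {a : ℝ} (ha : 1 < a) : Omega n (Q n a) = 2 * Omega n (Qfwd n a) := by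
  rw [Q_eq_union, measure_union _ ((measurePreserving_flip n).measurable (measurableSet_Qfwd n a)),
    Omega_flip_preimage n (measurableSet_Qfwd n a), two_mul]
  rw [Set.disjoint_left]
  rintro q ⟨⟨h1, -⟩, -⟩ ⟨⟨-, h2⟩, -⟩
  simp only [D, Dout, flip, mem_ofPred_eq] at h1 h2
  linarith

/-- The parameter interval that a geodesic joining `x` and `y` spends between the two half-spaces. -/
theorem Qfwd_slice {n : ℕ} {a : ℝ} (ha : 1 < a) {x y : Boundary n} (hx : ‖x‖ < 1) (hy : a < ‖y‖) :
    {t | (x, y, t) ∈ Qfwd n a} =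
      Icc (Real.log ((1 - ‖x‖ ^ 2) / (‖y‖ ^ 2 - 1)) / 2)
        (Real.log ((a ^ 2 - ‖x‖ ^ 2) / (‖y‖ ^ 2 - a ^ 2)) / 2) := by
  have hu : ‖x‖ ^ 2 < 1 := by nlinarith [norm_nonneg x]
  have hA : 1 < a ^ 2 := by nlinarith
  have hv : a ^ 2 < ‖y‖ ^ 2 := by nlinarith
  ext t
  have hE := Real.exp_pos (2 * t)
  have ht : Real.tanh t = (Real.exp (2 * t) - 1) / (Real.exp (2 * t) + 1) := by
    have := Real.exp_pos t
    rw [Real.tanh_eq_sinh_div_cosh, Real.sinh_eq, Real.cosh_eq, Real.exp_neg, two_mul, Real.exp_add]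
    field_simp
  -- A weighted mean of `‖x‖²` and `‖y‖²` with weights `1 : e^{2t}`; both constraints thus become
  -- linear in `e^{2t}`.
  have hN : (‖x‖ ^ 2 + ‖y‖ ^ 2) / 2 + Real.tanh t * (‖y‖ ^ 2 - ‖x‖ ^ 2) / 2 =
      (‖x‖ ^ 2 + Real.exp (2 * t) * ‖y‖ ^ 2) / (Real.exp (2 * t) + 1) := by
    rw [ht]
    field_simp
    ring
  simp only [Qfwd, basePoint_notMem_iff, norm_sq_basePoint, D, Dout, mem_ofPred_eq, hN, mem_Icc,
    hx.le, hy.le, and_self, true_and]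
  rw [div_le_iff₀ (c := 2) two_pos, le_div_iff₀ (c := 2) two_pos, mul_comm t,
    Real.log_le_iff_le_exp (by apply div_pos <;> linarith),
    Real.le_log_iff_exp_le (by apply div_pos <;> linarith),
    div_le_iff₀ (by linarith), le_div_iff₀ (by linarith), le_div_iff₀ (by linarith),
    div_le_iff₀ (by linarith)]
  constructor <;> rintro ⟨h1, h2⟩ <;> constructor <;> linarith

/-- Regrouping the four logarithms of the interval's endpoints separates `x` from `y`. Both groups
are nonnegative, so the sum splits in `ℝ≥0∞` too; this separation makes the double integral
computable. -/
theorem volume_Qfwd_slice {n : ℕ} {a : ℝ} (ha : 1 < a) {x y : Boundary n} (hx : ‖x‖ < 1)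
    (hy : a < ‖y‖) :
    volume {t | (x, y, t) ∈ Qfwd n a} =
      ENNReal.ofReal (Real.log ((a ^ 2 - ‖x‖ ^ 2) / (1 - ‖x‖ ^ 2)) / 2) +
        ENNReal.ofReal (Real.log ((‖y‖ ^ 2 - 1) / (‖y‖ ^ 2 - a ^ 2)) / 2) := by
  have hu : ‖x‖ ^ 2 < 1 := by nlinarith [norm_nonneg x]
  have hA : 1 < a ^ 2 := by nlinarith
  have hv : a ^ 2 < ‖y‖ ^ 2 := by nlinarith
  have h1 : 0 < 1 - ‖x‖ ^ 2 := by linarith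
  have h2 : 0 < a ^ 2 - ‖x‖ ^ 2 := by linarith
  have h3 : 0 < ‖y‖ ^ 2 - 1 := by linarith
  have h4 : 0 < ‖y‖ ^ 2 - a ^ 2 := by linarith
  rw [Qfwd_slice ha hx hy, Real.volume_Icc, ← ENNReal.ofReal_add]
  · congr 1
    rw [Real.log_div h2.ne' h4.ne', Real.log_div h1.ne' h3.ne', Real.log_div h2.ne' h1.ne',
      Real.log_div h3.ne' h4.ne']
    ring
  · exact div_nonneg (Real.log_nonneg ((one_le_div h1).2 (by linarith))) two_pos.le
  · exact div_nonneg (Real.log_nonneg ((one_le_div h4).2 (by linarith))) two_pos.le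

theorem Omega_Qfwd_eq_lintegral (n : ℕ) (a : ℝ) :
    Omega n (Qfwd n a) = ∫⁻ x : Boundary n, ∫⁻ y : Boundary n,
      ENNReal.ofReal (2 / ‖x - y‖ ^ (2 * n - 2)) * volume {t | (x, y, t) ∈ Qfwd n a} := by
  have hQ := measurableSet_Qfwd n a
  rw [Omega, withDensity_apply _ hQ, ← lintegral_indicator hQ, Measure.volume_eq_prod,
    lintegral_prod _ ((measurable_density n).indicator hQ).aemeasurable]
  refine lintegral_congr fun x => ?_
  have hx : Measurable fun p : Boundary n × ℝ => (Qfwd n a).indicator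
      (fun q => ENNReal.ofReal (2 / ‖q.1 - q.2.1‖ ^ (2 * n - 2))) (x, p) :=
    ((measurable_density n).indicator hQ).comp measurable_prodMk_left
  rw [Measure.volume_eq_prod, lintegral_prod _ hx.aemeasurable]
  refine lintegral_congr fun y => ?_
  have hS : MeasurableSet {t | (x, y, t) ∈ Qfwd n a} :=
    hQ.preimage (f := fun t : ℝ => (x, y, t)) (by fun_prop)
  rw [← setLIntegral_const, ← lintegral_indicator hS]
  rfl

/-! ### The kernel integrated over a ball or its exterior -/

theorem oppositeSide_eq_ball {E : Type*} [NormedAddCommGroup E] {c : E} {R : ℝ} (hR : 0 ≤ R)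
    (hc : R < ‖c‖) : oppositeSide c R = ball 0 R := by
  ext y
  have : 0 < ‖c‖ ^ 2 - R ^ 2 := by nlinarith
  rw [oppositeSide, mem_ofPred_eq, mul_comm, ← not_le, mul_nonneg_iff_of_pos_left this, not_le,
    mem_ball_zero_iff, sub_neg,
    pow_lt_pow_iff_left₀ (norm_nonneg y) hR two_ne_zero]

theorem oppositeSide_eq_compl {E : Type*} [NormedAddCommGroup E] {c : E} {R : ℝ}
    (hc : ‖c‖ < R) : oppositeSide c R = (closedBall 0 R)ᶜ := by
  ext y
  have hR : 0 ≤ R := (norm_nonneg c).trans hc.le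
  have : 0 < R ^ 2 - ‖c‖ ^ 2 := by nlinarith [norm_nonneg c]
  rw [oppositeSide, mem_ofPred_eq, mem_compl_iff, mem_closedBall_zero_iff, not_le,
    ← pow_lt_pow_iff_left₀ hR (norm_nonneg y) two_ne_zero, ← sub_pos (b := R ^ 2),
    ← mul_pos_iff_of_pos_right this]
  constructor <;> intro h <;> linarith

theorem ae_norm_ne {E : Type*} [NormedAddCommGroup E] [InnerProductSpace ℝ E]
    [FiniteDimensional ℝ E] [MeasurableSpace E] [BorelSpace E] [Nontrivial E] (μ : Measure E)
    [μ.IsAddHaarMeasure] (r : ℝ) : ∀ᵐ x ∂μ, ‖x‖ ≠ r := by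
  have := Measure.addHaar_sphere μ (0 : E) r
  rw [measure_eq_zero_iff_ae_notMem] at this
  filter_upwards [this] with x hx
  simpa using hx

section Kernel

variable {E : Type*} [NormedAddCommGroup E] [InnerProductSpace ℝ E] [FiniteDimensional ℝ E]
  [Nontrivial E] [MeasurableSpace E] [BorelSpace E]

theorem setLIntegral_compl_closedBall {d : ℕ} (hd : finrank ℝ E = d) (μ : Measure E)
    [μ.IsAddHaarMeasure] {a : ℝ} {x : E} (hx : ‖x‖ < a) :
    ∫⁻ y in (closedBall 0 a)ᶜ, ENNReal.ofReal (1 / ‖x - y‖ ^ (2 * d)) ∂μ =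
      ENNReal.ofReal ((a / (a ^ 2 - ‖x‖ ^ 2)) ^ d) * μ (ball 0 1) := by
  have h := lintegral_oppositeSide hd μ ((norm_nonneg x).trans_lt hx) hx.ne
  rwa [oppositeSide_eq_compl hx, abs_sub_comm, abs_of_pos (by nlinarith [norm_nonneg x])] at h

theorem setLIntegral_ball {d : ℕ} (hd : finrank ℝ E = d) (μ : Measure E)
    [μ.IsAddHaarMeasure] {y : E} (hy : 1 < ‖y‖) :
    ∫⁻ x in ball 0 1, ENNReal.ofReal (1 / ‖x - y‖ ^ (2 * d)) ∂μ =
      ENNReal.ofReal ((1 / (‖y‖ ^ 2 - 1)) ^ d) * μ (ball 0 1) := by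
  have h := lintegral_oppositeSide hd μ one_pos hy.ne'
  rw [oppositeSide_eq_ball zero_le_one hy, one_pow, abs_of_pos (by nlinarith)] at h
  simpa only [norm_sub_rev _ y] using h

/-- Each summand involves one variable only; Tonelli lets the kernel be integrated first in the
other one. -/
theorem lintegral_add_mul_kernel {d : ℕ} (hd : finrank ℝ E = d) (μ : Measure E)
    [μ.IsAddHaarMeasure] {a : ℝ} (ha : 1 < a) {α β : E → ℝ≥0∞} (hα : Measurable α)
    (hβ : Measurable β) :
    ∫⁻ x in ball 0 1, ∫⁻ y in (closedBall 0 a)ᶜ,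
      (α x + β y) * ENNReal.ofReal (1 / ‖x - y‖ ^ (2 * d)) ∂μ ∂μ =
    μ (ball 0 1) * ((∫⁻ x in ball 0 1, α x * ENNReal.ofReal ((a / (a ^ 2 - ‖x‖ ^ 2)) ^ d) ∂μ) +
      ∫⁻ y in (closedBall 0 a)ᶜ, β y * ENNReal.ofReal ((1 / (‖y‖ ^ 2 - 1)) ^ d) ∂μ) := by
  have hB : MeasurableSet (ball (0 : E) 1) := measurableSet_ball
  have hX : MeasurableSet (closedBall (0 : E) a)ᶜ := measurableSet_closedBall.compl
  calc _ = (∫⁻ x in ball 0 1, ∫⁻ y in (closedBall 0 a)ᶜ,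
              α x * ENNReal.ofReal (1 / ‖x - y‖ ^ (2 * d)) ∂μ ∂μ) +
            ∫⁻ x in ball 0 1, ∫⁻ y in (closedBall 0 a)ᶜ,
              β y * ENNReal.ofReal (1 / ‖x - y‖ ^ (2 * d)) ∂μ ∂μ := by
        rw [← lintegral_add_left]
        · refine lintegral_congr fun x => ?_
          rw [← lintegral_add_left (by fun_prop)]
          simp only [add_mul]
        · exact Measurable.lintegral_prod_right' (f := fun p : E × E =>
            α p.1 * ENNReal.ofReal (1 / ‖p.1 - p.2‖ ^ (2 * d))) (by fun_prop)
    _ = (∫⁻ x in ball 0 1, ∫⁻ y in (closedBall 0 a)ᶜ,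
              α x * ENNReal.ofReal (1 / ‖x - y‖ ^ (2 * d)) ∂μ ∂μ) +
            ∫⁻ y in (closedBall 0 a)ᶜ, ∫⁻ x in ball 0 1,
              β y * ENNReal.ofReal (1 / ‖x - y‖ ^ (2 * d)) ∂μ ∂μ := by
        congr 1
        exact lintegral_lintegral_swap (by fun_prop)
    _ = _ := by
        rw [mul_add, ← lintegral_const_mul _ (by fun_prop), ← lintegral_const_mul _ (by fun_prop)]
        congr 1
        · refine setLIntegral_congr_fun hB fun x hx => ?_
          have hx1 : ‖x‖ < a := (mem_ball_zero_iff.1 hx).trans ha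
          rw [lintegral_const_mul _ (by fun_prop), setLIntegral_compl_closedBall hd μ hx1]
          ring
        · refine setLIntegral_congr_fun hX fun y hy => ?_
          have hy1 : 1 < ‖y‖ := ha.trans (by simpa using hy)
          rw [lintegral_const_mul _ (by fun_prop), setLIntegral_ball hd μ hy1]
          ring

end Kernel

/-! ### Reduction to a one-dimensional integral -/

theorem setLIntegral_fun_norm_addHaar {E : Type*} [NormedAddCommGroup E] [NormedSpace ℝ E]
    [FiniteDimensional ℝ E] [Nontrivial E] [MeasurableSpace E] [BorelSpace E] (μ : Measure E)
    [μ.IsAddHaarMeasure] {f : ℝ → ℝ≥0∞} (hf : Measurable f) {s : Set ℝ} (hs : MeasurableSet s) :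
    ∫⁻ x in {x | ‖x‖ ∈ s}, f ‖x‖ ∂μ = finrank ℝ E * μ (ball 0 1) *
      ∫⁻ r in Ioi (0 : ℝ) ∩ s, ENNReal.ofReal (r ^ (finrank ℝ E - 1)) * f r := by
  have h := lintegral_fun_norm_addHaar μ (hf.indicator hs)
  have h1 : MeasurableSet {x : E | ‖x‖ ∈ s} := hs.preimage measurable_norm
  rw [← lintegral_indicator h1, inter_comm, ← Measure.restrict_restrict hs,
    ← lintegral_indicator hs]
  refine Eq.trans ?_ (h.trans ?_)
  · rfl
  · congr 2
    funext r
    by_cases hr : r ∈ s <;> simp [hr]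

/-- The weight `((1 - y) (1 - y / A)) ^ (m / 2)`. -/
def weight (m : ℕ) (A y : ℝ) : ℝ := √((1 - y) * (1 - y / A)) ^ m

theorem continuous_weight (m : ℕ) (A : ℝ) : Continuous (weight m A) := by
  unfold weight
  fun_prop

/-- Substitute `y = a²(1 - r²) / (a² - r²)`: the logarithm becomes `log a² - log y`, and `(1 - y)(1
- y / a²)` is the perfect square of `r (a² - 1) / (a² - r²)`. -/
theorem lintegral_inner_substitution (m : ℕ) {a : ℝ} (ha : 1 < a) :
    ∫⁻ r in Ioo (0 : ℝ) 1, ENNReal.ofReal (r ^ (m + 1)) *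
      (ENNReal.ofReal (Real.log ((a ^ 2 - r ^ 2) / (1 - r ^ 2))) *
        ENNReal.ofReal ((a / (a ^ 2 - r ^ 2)) ^ (m + 2))) =
    ENNReal.ofReal (a ^ m / (2 * (a ^ 2 - 1) ^ (m + 1))) *
      ∫⁻ y in Ioo (0 : ℝ) 1, ENNReal.ofReal (weight m (a ^ 2) y) *
        ENNReal.ofReal (Real.log (a ^ 2) - Real.log y) := by
  have hA : 0 < a ^ 2 - 1 := by nlinarith
  have ha0 : 0 < a := by linarith
  have key : ∀ r ∈ Ioo (0 : ℝ) 1, 0 < r ∧ 0 < 1 - r ^ 2 ∧ 0 < a ^ 2 - r ^ 2 := by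
    rintro r ⟨h0, h1⟩
    exact ⟨h0, by nlinarith, by nlinarith⟩
  have himg : (fun r : ℝ => a ^ 2 * (1 - r ^ 2) / (a ^ 2 - r ^ 2)) '' Ioo 0 1 = Ioo 0 1 := by
    ext y
    constructor
    · rintro ⟨r, hr, rfl⟩
      obtain ⟨h0, h1, h2⟩ := key r hr
      refine ⟨by positivity, ?_⟩
      rw [div_lt_one h2]
      nlinarith [mul_pos (pow_pos h0 2) hA]
    · rintro ⟨h0, h1⟩
      have hy : 0 < a ^ 2 - y := by linarith
      have hq : 0 < a ^ 2 * (1 - y) / (a ^ 2 - y) := by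
        have : 0 < 1 - y := by linarith
        positivity
      -- The map `u ↦ a²(1 - u) / (a² - u)` is an involution, so it also gives `r²` in terms of `y`.
      refine ⟨√(a ^ 2 * (1 - y) / (a ^ 2 - y)), ⟨Real.sqrt_pos.2 hq, ?_⟩, ?_⟩
      · rw [Real.sqrt_lt' one_pos, one_pow, div_lt_one hy]
        nlinarith
      · simp only
        rw [Real.sq_sqrt hq.le]
        have e : a ^ 2 - a ^ 2 * (1 - y) / (a ^ 2 - y) = a ^ 2 * (a ^ 2 - 1) / (a ^ 2 - y) := by
          field_simp
          ring
        have e' : 1 - a ^ 2 * (1 - y) / (a ^ 2 - y) = y * (a ^ 2 - 1) / (a ^ 2 - y) := by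
          field_simp
          ring
        rw [e, e']
        field_simp
  have hinj : InjOn (fun r : ℝ => a ^ 2 * (1 - r ^ 2) / (a ^ 2 - r ^ 2)) (Ioo 0 1) := by
    intro r hr s hs h
    obtain ⟨h0, h1, h2⟩ := key r hr
    obtain ⟨h0', h1', h2'⟩ := key s hs
    simp only at h
    rw [div_eq_div_iff h2.ne' h2'.ne'] at h
    have : a ^ 2 * (a ^ 2 - 1) * (r ^ 2 - s ^ 2) = 0 := by linarith
    have h3 : r ^ 2 = s ^ 2 := by
      rcases mul_eq_zero.1 this with h | h
      · exact absurd h (by positivity)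
      · linarith
    exact (pow_left_inj₀ h0.le h0'.le two_ne_zero).1 h3
  have hder : ∀ r ∈ Ioo (0 : ℝ) 1, HasDerivWithinAt
      (fun r : ℝ => a ^ 2 * (1 - r ^ 2) / (a ^ 2 - r ^ 2))
      (-(2 * r * a ^ 2 * (a ^ 2 - 1) / (a ^ 2 - r ^ 2) ^ 2)) (Ioo 0 1) r := by
    intro r hr
    obtain ⟨h0, h1, h2⟩ := key r hr
    have d2 := hasDerivAt_pow 2 r
    have h := ((d2.const_sub 1).const_mul (a ^ 2)).div (d2.const_sub (a ^ 2)) h2.ne'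
    refine (h.congr_deriv ?_).hasDerivWithinAt
    push_cast
    field_simp
    ring
  have hsub := lintegral_image_eq_lintegral_abs_deriv_mul measurableSet_Ioo hder hinj
    fun y => ENNReal.ofReal (weight m (a ^ 2) y) * ENNReal.ofReal (Real.log (a ^ 2) - Real.log y)
  rw [himg] at hsub
  rw [hsub, ← lintegral_const_mul' _ _ ENNReal.ofReal_ne_top]
  refine setLIntegral_congr_fun measurableSet_Ioo fun r hr => ?_
  obtain ⟨h0, h1, h2⟩ := key r hr
  have hlog : Real.log (a ^ 2) - Real.log (a ^ 2 * (1 - r ^ 2) / (a ^ 2 - r ^ 2)) =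
      Real.log ((a ^ 2 - r ^ 2) / (1 - r ^ 2)) := by
    rw [Real.log_div (by positivity) h2.ne', Real.log_mul (by positivity) h1.ne',
      Real.log_div h2.ne' h1.ne']
    ring
  have hw : weight m (a ^ 2) (a ^ 2 * (1 - r ^ 2) / (a ^ 2 - r ^ 2)) =
      (r * (a ^ 2 - 1) / (a ^ 2 - r ^ 2)) ^ m := by
    rw [weight]
    congr 1
    rw [Real.sqrt_eq_iff_mul_self_eq_of_pos (by positivity)]
    field_simp
    ring
  rw [hlog, hw, abs_neg, abs_of_pos (by positivity)]
  have hreal : r ^ (m + 1) * (a / (a ^ 2 - r ^ 2)) ^ (m + 2) = a ^ m / (2 * (a ^ 2 - 1) ^ (m + 1)) *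
      (2 * r * a ^ 2 * (a ^ 2 - 1) / (a ^ 2 - r ^ 2) ^ 2 * ((r * (a ^ 2 - 1) / (a ^ 2 - r ^ 2)) ^ m)) := by
    simp only [div_pow, mul_pow]
    field_simp
    ring
  have hennreal := congrArg ENNReal.ofReal hreal
  rw [ENNReal.ofReal_mul (by positivity), ENNReal.ofReal_mul (by positivity),
    ENNReal.ofReal_mul (by positivity)] at hennreal
  rw [mul_comm (ENNReal.ofReal (Real.log _)), ← mul_assoc, hennreal]
  ring

/-- Substitute `y = (s² - a²) / (s² - 1)`. The weight and prefactor agree with those of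
`lintegral_inner_substitution`, so the two integrals add up to one. -/
theorem lintegral_outer_substitution (m : ℕ) {a : ℝ} (ha : 1 < a) :
    ∫⁻ s in Ioi a, ENNReal.ofReal (s ^ (m + 1)) *
      (ENNReal.ofReal (Real.log ((s ^ 2 - 1) / (s ^ 2 - a ^ 2))) *
        ENNReal.ofReal ((1 / (s ^ 2 - 1)) ^ (m + 2))) =
    ENNReal.ofReal (a ^ m / (2 * (a ^ 2 - 1) ^ (m + 1))) *
      ∫⁻ y in Ioo (0 : ℝ) 1, ENNReal.ofReal (weight m (a ^ 2) y) *
        ENNReal.ofReal (-Real.log y) := by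
  have hA : 0 < a ^ 2 - 1 := by nlinarith
  have ha0 : 0 < a := by linarith
  have key : ∀ s ∈ Ioi a, 0 < s ∧ 0 < s ^ 2 - 1 ∧ 0 < s ^ 2 - a ^ 2 := by
    intro s (hs : a < s)
    exact ⟨by linarith, by nlinarith, by nlinarith⟩
  have himg : (fun s : ℝ => (s ^ 2 - a ^ 2) / (s ^ 2 - 1)) '' Ioi a = Ioo 0 1 := by
    ext y
    constructor
    · rintro ⟨r, hr, rfl⟩
      obtain ⟨h0, h1, h2⟩ := key r hr
      refine ⟨by positivity, ?_⟩
      rw [div_lt_one h1]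
      linarith
    · rintro ⟨h0, h1⟩
      have hy : 0 < 1 - y := by linarith
      have hq : 0 < (a ^ 2 - y) / (1 - y) := div_pos (by linarith) hy
      refine ⟨√((a ^ 2 - y) / (1 - y)), ?_, ?_⟩
      · rw [mem_Ioi, Real.lt_sqrt ha0.le, lt_div_iff₀ hy]
        nlinarith
      · simp only
        rw [Real.sq_sqrt hq.le]
        have e : (a ^ 2 - y) / (1 - y) - a ^ 2 = y * (a ^ 2 - 1) / (1 - y) := by
          field_simp
          ring
        have e' : (a ^ 2 - y) / (1 - y) - 1 = (a ^ 2 - 1) / (1 - y) := by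
          field_simp
          ring
        rw [e, e']
        field_simp
  have hinj : InjOn (fun s : ℝ => (s ^ 2 - a ^ 2) / (s ^ 2 - 1)) (Ioi a) := by
    intro r hr s hs h
    obtain ⟨h0, h1, h2⟩ := key r hr
    obtain ⟨h0', h1', h2'⟩ := key s hs
    simp only at h
    rw [div_eq_div_iff h1.ne' h1'.ne'] at h
    have : (a ^ 2 - 1) * (r ^ 2 - s ^ 2) = 0 := by linarith
    have h3 : r ^ 2 = s ^ 2 := by
      rcases mul_eq_zero.1 this with h | h
      · exact absurd h hA.ne'
      · linarith
    exact (pow_left_inj₀ h0.le h0'.le two_ne_zero).1 h3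
  have hder : ∀ s ∈ Ioi a, HasDerivWithinAt (fun s : ℝ => (s ^ 2 - a ^ 2) / (s ^ 2 - 1))
      (2 * s * (a ^ 2 - 1) / (s ^ 2 - 1) ^ 2) (Ioi a) s := by
    intro s hs
    obtain ⟨h0, h1, h2⟩ := key s hs
    have d2 := hasDerivAt_pow 2 s
    have h := (d2.sub_const (a ^ 2)).div (d2.sub_const 1) h1.ne'
    refine (h.congr_deriv ?_).hasDerivWithinAt
    push_cast
    field_simp
    ring
  have hsub := lintegral_image_eq_lintegral_abs_deriv_mul measurableSet_Ioi hder hinj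
    fun y => ENNReal.ofReal (weight m (a ^ 2) y) * ENNReal.ofReal (-Real.log y)
  rw [himg] at hsub
  rw [hsub, ← lintegral_const_mul' _ _ ENNReal.ofReal_ne_top]
  refine setLIntegral_congr_fun measurableSet_Ioi fun s hs => ?_
  obtain ⟨h0, h1, h2⟩ := key s hs
  have hlog : -Real.log ((s ^ 2 - a ^ 2) / (s ^ 2 - 1)) =
      Real.log ((s ^ 2 - 1) / (s ^ 2 - a ^ 2)) := by
    rw [← Real.log_inv, inv_div]
  have hw : weight m (a ^ 2) ((s ^ 2 - a ^ 2) / (s ^ 2 - 1)) =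
      (s * (a ^ 2 - 1) / (a * (s ^ 2 - 1))) ^ m := by
    rw [weight]
    congr 1
    rw [Real.sqrt_eq_iff_mul_self_eq_of_pos (by positivity)]
    field_simp
    ring
  rw [hlog, hw, abs_of_pos (by positivity)]
  have hreal : s ^ (m + 1) * (1 / (s ^ 2 - 1)) ^ (m + 2) = a ^ m / (2 * (a ^ 2 - 1) ^ (m + 1)) *
      (2 * s * (a ^ 2 - 1) / (s ^ 2 - 1) ^ 2 * ((s * (a ^ 2 - 1) / (a * (s ^ 2 - 1))) ^ m)) := by
    simp only [div_pow, mul_pow]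
    field_simp
    ring
  have hennreal := congrArg ENNReal.ofReal hreal
  rw [ENNReal.ofReal_mul (by positivity), ENNReal.ofReal_mul (by positivity),
    ENNReal.ofReal_mul (by positivity)] at hennreal
  rw [mul_comm (ENNReal.ofReal (Real.log _)), ← mul_assoc, hennreal]
  ring

theorem volume_Qfwd_slice_eq_zero {n : ℕ} {a : ℝ} {x y : Boundary n} (h : 1 < ‖x‖ ∨ ‖y‖ < a) :
    volume {t | (x, y, t) ∈ Qfwd n a} = 0 := by
  have : {t | (x, y, t) ∈ Qfwd n a} = ∅ := by
    rw [eq_empty_iff_forall_notMem]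
    rintro t ⟨⟨h1, h2⟩, -⟩
    exact h.elim (fun h => h.not_ge h1) (fun h => h.not_ge h2)
  rw [this, measure_empty]

/-- The spheres `‖x‖ = 1` and `‖y‖ = a` are null, so the slice formula for strict inequalities
suffices. The factor 2 of the density absorbs the halves in the slice length. -/
theorem Omega_Qfwd_eq_setLIntegral (m : ℕ) {a : ℝ} (ha : 1 < a) :
    Omega (m + 3) (Qfwd (m + 3) a) =
      ∫⁻ x in ball (0 : Boundary (m + 3)) 1, ∫⁻ y in (closedBall (0 : Boundary (m + 3)) a)ᶜ,
        (ENNReal.ofReal (Real.log ((a ^ 2 - ‖x‖ ^ 2) / (1 - ‖x‖ ^ 2))) +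
          ENNReal.ofReal (Real.log ((‖y‖ ^ 2 - 1) / (‖y‖ ^ 2 - a ^ 2)))) *
            ENNReal.ofReal (1 / ‖x - y‖ ^ (2 * (m + 2))) := by
  have hne : Nonempty (Fin (m + 3 - 1)) := ⟨⟨0, by omega⟩⟩
  have hB : MeasurableSet (ball (0 : Boundary (m + 3)) 1) := measurableSet_ball
  have hX : MeasurableSet (closedBall (0 : Boundary (m + 3)) a)ᶜ := measurableSet_closedBall.compl
  rw [Omega_Qfwd_eq_lintegral, ← lintegral_indicator hB]
  refine lintegral_congr_ae ?_
  filter_upwards [ae_norm_ne volume (1 : ℝ)] with x hx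
  rcases hx.lt_or_gt with hx | hx
  · rw [indicator_of_mem (mem_ball_zero_iff.2 hx), ← lintegral_indicator hX]
    refine lintegral_congr_ae ?_
    filter_upwards [ae_norm_ne volume a] with y hy
    rcases hy.lt_or_gt with hy | hy
    · rw [indicator_of_notMem (by simpa using hy.le), volume_Qfwd_slice_eq_zero (Or.inr hy),
        mul_zero]
    · rw [indicator_of_mem (by simpa using hy), volume_Qfwd_slice ha hx hy, mul_add, add_mul,
        ← ENNReal.ofReal_mul (by positivity), ← ENNReal.ofReal_mul (by positivity),
        ← ENNReal.ofReal_mul' (by positivity), ← ENNReal.ofReal_mul' (by positivity),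
        show 2 * (m + 3) - 2 = 2 * (m + 2) by omega]
      congr 2 <;> ring
  · rw [indicator_of_notMem (by simpa using hx.le)]
    simp [volume_Qfwd_slice_eq_zero (Or.inl hx)]

/-- The factor 2 counts the two directions; polar coordinates give `m + 2` and one ball volume, and
the kernel integral gives the other ball volume. -/
theorem Omega_Q_eq_lintegral (m : ℕ) {a : ℝ} (ha : 1 < a) :
    Omega (m + 3) (Q (m + 3) a) =
      2 * (m + 2) * volume (ball (0 : Boundary (m + 3)) 1) ^ 2 *
        ENNReal.ofReal (a ^ m / (2 * (a ^ 2 - 1) ^ (m + 1))) *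
          ∫⁻ y in Ioo (0 : ℝ) 1,
            ENNReal.ofReal (weight m (a ^ 2) y * (Real.log (a ^ 2) - 2 * Real.log y)) := by
  have hne : Nonempty (Fin (m + 3 - 1)) := ⟨⟨0, by omega⟩⟩
  have hd : finrank ℝ (Boundary (m + 3)) = m + 2 := by simp
  have hla : 0 ≤ Real.log (a ^ 2) := Real.log_nonneg (by nlinarith)
  have h1 : {x : Boundary (m + 3) | ‖x‖ ∈ Iio (1 : ℝ)} = ball 0 1 := by
    ext x; simp
  have h2 : {x : Boundary (m + 3) | ‖x‖ ∈ Ioi a} = (closedBall 0 a)ᶜ := by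
    ext x; simp
  have hα : Measurable fun r : ℝ => ENNReal.ofReal (Real.log ((a ^ 2 - r ^ 2) / (1 - r ^ 2))) := by
    fun_prop
  have hβ : Measurable fun s : ℝ => ENNReal.ofReal (Real.log ((s ^ 2 - 1) / (s ^ 2 - a ^ 2))) := by
    fun_prop
  have e1 := setLIntegral_fun_norm_addHaar (volume : Measure (Boundary (m + 3)))
    (f := fun r => ENNReal.ofReal (Real.log ((a ^ 2 - r ^ 2) / (1 - r ^ 2))) *
      ENNReal.ofReal ((a / (a ^ 2 - r ^ 2)) ^ (m + 2))) (by fun_prop) (measurableSet_Iio (a := 1))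
  have e2 := setLIntegral_fun_norm_addHaar (volume : Measure (Boundary (m + 3)))
    (f := fun s => ENNReal.ofReal (Real.log ((s ^ 2 - 1) / (s ^ 2 - a ^ 2))) *
      ENNReal.ofReal ((1 / (s ^ 2 - 1)) ^ (m + 2))) (by fun_prop) (measurableSet_Ioi (a := a))
  rw [h1, hd, Ioi_inter_Iio, show m + 2 - 1 = m + 1 by omega,
    lintegral_inner_substitution m ha] at e1
  rw [h2, hd, inter_eq_self_of_subset_right (Ioi_subset_Ioi (by linarith)),
    show m + 2 - 1 = m + 1 by omega, lintegral_outer_substitution m ha] at e2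
  have e3 : ∫⁻ y in Ioo (0 : ℝ) 1,
      ENNReal.ofReal (weight m (a ^ 2) y * (Real.log (a ^ 2) - 2 * Real.log y)) =
      (∫⁻ y in Ioo (0 : ℝ) 1, ENNReal.ofReal (weight m (a ^ 2) y) *
        ENNReal.ofReal (Real.log (a ^ 2) - Real.log y)) +
      ∫⁻ y in Ioo (0 : ℝ) 1, ENNReal.ofReal (weight m (a ^ 2) y) *
        ENNReal.ofReal (-Real.log y) := by
    have hwm := (continuous_weight m (a ^ 2)).measurable
    rw [← lintegral_add_left (by fun_prop)]
    refine setLIntegral_congr_fun measurableSet_Ioo fun y hy => ?_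
    have hy : Real.log y ≤ 0 := Real.log_nonpos hy.1.le hy.2.le
    rw [← mul_add, ← ENNReal.ofReal_add (by linarith) (by linarith),
      ← ENNReal.ofReal_mul (by unfold weight; positivity)]
    congr 2
    ring
  have e0 := lintegral_add_mul_kernel hd volume ha (hα.comp measurable_norm)
    (hβ.comp measurable_norm)
  simp only [Function.comp_def] at e0
  rw [Omega_Q ha, Omega_Qfwd_eq_setLIntegral m ha, e0, e1, e2, e3]
  push_cast
  ring

end Volume

/-! ### The one-dimensional integral as a function of `l` -/

section Asymptotics

open Set Filter Metric intervalIntegral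
open scoped Topology

theorem weight_nonneg (m : ℕ) (A y : ℝ) : 0 ≤ weight m A y := pow_nonneg (Real.sqrt_nonneg _) m

theorem weight_le_one (m : ℕ) {A y : ℝ} (hA : 1 ≤ A) (hy0 : 0 ≤ y) (hy1 : y ≤ 1) :
    weight m A y ≤ 1 := by
  have h1 : y / A ≤ 1 := (div_le_one (by linarith)).2 (by linarith)
  have h2 : 0 ≤ y / A := by positivity
  refine pow_le_one₀ (Real.sqrt_nonneg _) (Real.sqrt_le_one.2 ?_)
  nlinarith

theorem weight_pos (m : ℕ) {A y : ℝ} (hA : 1 ≤ A) (hy0 : 0 < y) (hy1 : y < 1) :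
    0 < weight m A y := by
  have h1 : y / A < 1 := (div_lt_one (by linarith)).2 (by linarith)
  exact pow_pos (Real.sqrt_pos.2 (mul_pos (by linarith) (by linarith))) m

/-- The weighted integral of `l - log y` over the unit interval. -/
def logIntegral (m : ℕ) (l : ℝ) : ℝ :=
  ∫ y in (0 : ℝ)..1, weight m (Real.exp (2 * l)) y * (l - Real.log y)

theorem intervalIntegrable_sub_log (c a b : ℝ) :
    IntervalIntegrable (fun y => c - Real.log y) volume a b :=
  intervalIntegrable_const.sub intervalIntegrable_log'

theorem intervalIntegrable_weight_mul (m : ℕ) (A l : ℝ) :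
    IntervalIntegrable (fun y => weight m A y * (l - Real.log y)) volume 0 1 :=
  (intervalIntegrable_sub_log l 0 1).continuousOn_mul (continuous_weight m A).continuousOn

theorem logIntegral_pos (m : ℕ) {l : ℝ} (hl : 0 ≤ l) : 0 < logIntegral m l := by
  refine intervalIntegral_pos_of_pos_on (intervalIntegrable_weight_mul m _ l) ?_ one_pos
  intro y hy
  have := Real.log_neg hy.1 hy.2
  exact mul_pos (weight_pos m (Real.one_le_exp (by linarith)) hy.1 hy.2) (by linarith)

theorem logIntegral_le (m : ℕ) {l : ℝ} (hl : 0 ≤ l) : logIntegral m l ≤ l + 1 := by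
  have h : ∫ y in (0 : ℝ)..1, (l - Real.log y) = l + 1 := by
    rw [integral_sub intervalIntegrable_const intervalIntegrable_log', integral_log]
    simp
  rw [← h]
  refine integral_mono_on zero_le_one (intervalIntegrable_weight_mul m _ l)
    (intervalIntegrable_sub_log l 0 1) fun y hy => ?_
  have := Real.log_nonpos hy.1 hy.2
  exact mul_le_of_le_one_left (by linarith)
    (weight_le_one m (Real.one_le_exp (by linarith)) hy.1 hy.2)

/-- The endpoint 0 is included because the value there determines the limit of `F` in
`tendsto_F_zero`. -/
theorem continuousOn_logIntegral (m : ℕ) : ContinuousOn (logIntegral m) (Ici 0) := by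
  intro l₀ hl₀
  refine continuousWithinAt_of_dominated_interval (bound := fun y => (l₀ + 1) - Real.log y)
    ?_ ?_ (intervalIntegrable_sub_log _ 0 1) ?_
  · refine Eventually.of_forall fun l => ?_
    have := (continuous_weight m (Real.exp (2 * l))).measurable
    exact Measurable.aestronglyMeasurable (by fun_prop)
  · have h1 : ∀ᶠ l in 𝓝[Ici 0] l₀, l < l₀ + 1 :=
      nhdsWithin_le_nhds (Iio_mem_nhds (by linarith))
    filter_upwards [h1, self_mem_nhdsWithin] with l hl (hl0 : 0 ≤ l)
    refine Eventually.of_forall fun y hy => ?_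
    rw [uIoc_of_le zero_le_one] at hy
    have hlog := Real.log_nonpos hy.1.le hy.2
    rw [Real.norm_of_nonneg (mul_nonneg (weight_nonneg _ _ _) (by linarith))]
    calc _ ≤ 1 * (l - Real.log y) := by
          refine mul_le_mul_of_nonneg_right ?_ (by linarith)
          exact weight_le_one m (Real.one_le_exp (by linarith)) hy.1.le hy.2
      _ ≤ _ := by linarith
  · refine Eventually.of_forall fun y _ => Continuous.continuousWithinAt ?_
    unfold weight
    have : ∀ l : ℝ, Real.exp (2 * l) ≠ 0 := fun l => (Real.exp_pos _).ne'
    fun_prop (disch := exact this _)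

/-- The substitution `z = e⁻ˡ y`, after which the integrand is decreasing in `l`. -/
theorem exp_neg_mul_logIntegral (m : ℕ) (l : ℝ) :
    Real.exp (-l) * logIntegral m l =
      ∫ z in (0 : ℝ)..Real.exp (-l),
        √(1 - 2 * Real.cosh l * z + z ^ 2) ^ m * (-Real.log z) := by
  have h := intervalIntegral.mul_integral_comp_mul_left (a := 0) (b := 1)
    (f := fun z => √(1 - 2 * Real.cosh l * z + z ^ 2) ^ m * (-Real.log z)) (Real.exp (-l))
  rw [mul_zero, mul_one] at h
  rw [← h, logIntegral]
  congr 1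
  refine integral_congr_ae (Eventually.of_forall fun y hy => ?_)
  rw [uIoc_of_le zero_le_one] at hy
  have he := Real.exp_pos (-l)
  rw [Real.log_mul he.ne' hy.1.ne', Real.log_exp, weight]
  have : (1 - y) * (1 - y / Real.exp (2 * l)) =
      1 - 2 * Real.cosh l * (Real.exp (-l) * y) + (Real.exp (-l) * y) ^ 2 := by
    rw [Real.cosh_eq, two_mul l, Real.exp_add, Real.exp_neg]
    field_simp
    ring
  rw [this]
  ring

/-- As `l` grows, the interval `[0, e^{-l}]` shrinks and `1 - 2 cosh l * z + z²` decreases for `z ≥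
0`, while `-log z ≥ 0` there. -/
theorem antitoneOn_exp_neg_mul_logIntegral (m : ℕ) :
    AntitoneOn (fun l => Real.exp (-l) * logIntegral m l) (Ioi 0) := by
  intro l₁ (h₁ : 0 < l₁) l₂ (h₂ : 0 < l₂) hle
  simp only [exp_neg_mul_logIntegral]
  have hint : ∀ l b : ℝ, IntervalIntegrable
      (fun z => √(1 - 2 * Real.cosh l * z + z ^ 2) ^ m * (-Real.log z)) volume 0 b := fun l b =>
    intervalIntegrable_log'.neg.continuousOn_mul (Continuous.continuousOn (by fun_prop))
  have hexp : Real.exp (-l₂) ≤ Real.exp (-l₁) := Real.exp_le_exp.2 (by linarith)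
  have hexp1 : Real.exp (-l₁) ≤ 1 := Real.exp_le_one_iff.2 (by linarith)
  calc _ ≤ ∫ z in (0 : ℝ)..Real.exp (-l₂),
        √(1 - 2 * Real.cosh l₁ * z + z ^ 2) ^ m * (-Real.log z) := by
        refine integral_mono_on (Real.exp_pos _).le (hint _ _) (hint _ _) fun z hz => ?_
        have hlog := Real.log_nonpos hz.1 (hz.2.trans (hexp.trans hexp1))
        have hcosh : Real.cosh l₁ ≤ Real.cosh l₂ := by
          rw [Real.cosh_le_cosh, abs_of_pos h₁, abs_of_pos h₂]
          exact hle
        refine mul_le_mul_of_nonneg_right (pow_le_pow_left₀ (Real.sqrt_nonneg _) ?_ m)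
          (by linarith)
        refine Real.sqrt_le_sqrt ?_
        nlinarith [hz.1]
    _ ≤ _ := by
        refine integral_mono_interval le_rfl (Real.exp_pos _).le hexp ?_ (hint _ _)
        rw [EventuallyLE, ae_restrict_iff' measurableSet_Ioc]
        refine Eventually.of_forall fun z hz => ?_
        have hlog := Real.log_nonpos hz.1.le (hz.2.trans hexp1)
        exact mul_nonneg (by positivity) (by linarith)

theorem P_one_eq_sum_range (m : ℕ) : P m 1 = ∑ k ∈ Finset.range m, 1 / ((k : ℝ) + 1) := by
  induction m with
  | zero => simp [P]
  | succ m ih =>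
    rw [Finset.sum_range_succ, ← ih, P, P, Finset.sum_Icc_succ_top (by omega)]
    simp

/-- At `l = 0` the weight is `(1 - y)^m`, and integration by parts gives the explicit primitive `G`,
which vanishes at 1 and yields the harmonic sum at 0. -/
theorem logIntegral_zero (m : ℕ) : logIntegral m 0 = P (m + 1) 1 / (m + 1) := by
  set G : ℝ → ℝ := fun y =>
    (-(y * Real.log y) * (∑ k ∈ Finset.range (m + 1), (1 - y) ^ k)
      - ∑ k ∈ Finset.range (m + 1), (1 - y) ^ (k + 1) / (k + 1)) / (m + 1) with hG
  have hcont : ContinuousOn G (Icc 0 1) := by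
    refine Continuous.continuousOn ?_
    have := Real.continuous_mul_log
    fun_prop
  have hgeom : ∀ y : ℝ, y * (∑ k ∈ Finset.range (m + 1), (1 - y) ^ k) = 1 - (1 - y) ^ (m + 1) := by
    intro y
    have := mul_neg_geom_sum (1 - y) (m + 1)
    rwa [sub_sub_cancel] at this
  have hder : ∀ y ∈ Ioo (0 : ℝ) 1, HasDerivAt G ((1 - y) ^ m * (0 - Real.log y)) y := by
    intro y hy
    -- The form with `y log y` is continuous at 0; this one, equal by the geometric sum, is easier
    -- to differentiate.
    have hG' : G = fun y => (-Real.log y * (1 - (1 - y) ^ (m + 1))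
      - ∑ k ∈ Finset.range (m + 1), (1 - y) ^ (k + 1) / (k + 1)) / (m + 1) := by
      funext z
      rw [hG, ← hgeom z]
      ring
    have hid : HasDerivAt (fun y : ℝ => 1 - y) (-1) y := by
      simpa using (hasDerivAt_id y).const_sub 1
    have hsum : HasDerivAt (fun y : ℝ => ∑ k ∈ Finset.range (m + 1), (1 - y) ^ (k + 1) / (k + 1))
        (-∑ k ∈ Finset.range (m + 1), (1 - y) ^ k) y := by
      rw [← Finset.sum_neg_distrib]
      refine HasDerivAt.fun_sum fun k _ => ?_
      refine ((hid.fun_pow (k + 1)).div_const _).congr_deriv ?_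
      have : (k : ℝ) + 1 ≠ 0 := by positivity
      push_cast
      field_simp
    rw [hG']
    refine ((((Real.hasDerivAt_log hy.1.ne').fun_neg.fun_mul
      ((hid.fun_pow (m + 1)).const_sub 1)).fun_sub hsum).div_const _).congr_deriv ?_
    rw [← hgeom y]
    have : (m : ℝ) + 1 ≠ 0 := by positivity
    have := hy.1.ne'
    push_cast
    field_simp
    ring
  have hw : ∀ y ∈ uIcc (0 : ℝ) 1, weight m (Real.exp (2 * 0)) y * (0 - Real.log y) =
      (1 - y) ^ m * (0 - Real.log y) := by
    intro y hy
    rw [uIcc_of_le zero_le_one] at hy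
    rw [weight, mul_zero, Real.exp_zero, div_one, Real.sqrt_mul_self (by linarith [hy.2])]
  rw [logIntegral, integral_congr hw, integral_eq_sub_of_hasDerivAt_of_le zero_le_one hcont hder]
  · simp [hG, P_one_eq_sum_range, neg_div]
  · exact (intervalIntegrable_sub_log 0 0 1).continuousOn_mul (by fun_prop)

theorem integral_sqrt_one_sub_pow (m : ℕ) :
    ∫ y in (0 : ℝ)..1, √(1 - y) ^ m = 2 / (m + 2) := by
  rw [intervalIntegral.integral_comp_sub_left (fun y => √y ^ m) 1, sub_self, sub_zero]
  have h : ∀ y ∈ uIcc (0 : ℝ) 1, √y ^ m = y ^ ((m : ℝ) / 2) := by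
    intro y hy
    rw [uIcc_of_le zero_le_one] at hy
    rw [Real.sqrt_eq_rpow, ← Real.rpow_natCast, ← Real.rpow_mul hy.1]
    ring_nf
  have hm : (0 : ℝ) ≤ m := m.cast_nonneg
  rw [integral_congr h, integral_rpow (Or.inl (by linarith)), Real.one_rpow,
    Real.zero_rpow (by positivity)]
  field_simp
  ring

/-- Dividing by `l` turns the log factor into `1 - log y / l`, dominated by `1 - log y` once `l ≥
1`; the weight tends to `√(1 - y) ^ m`. -/
theorem tendsto_logIntegral_div (m : ℕ) :
    Tendsto (fun l => logIntegral m l / l) atTop (𝓝 (2 / (m + 2))) := by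
  rw [← integral_sqrt_one_sub_pow]
  have h : ∀ᶠ l : ℝ in atTop, ∫ y in (0 : ℝ)..1,
      weight m (Real.exp (2 * l)) y * (1 - Real.log y / l) = logIntegral m l / l := by
    filter_upwards [eventually_gt_atTop 0] with l hl
    rw [logIntegral, ← intervalIntegral.integral_div]
    congr 1
    funext y
    field_simp
  refine Tendsto.congr' h ?_
  refine tendsto_integral_filter_of_dominated_convergence (fun y => 1 - Real.log y) ?_ ?_
    (intervalIntegrable_sub_log 1 0 1) ?_
  · refine Eventually.of_forall fun l => ?_
    have := (continuous_weight m (Real.exp (2 * l))).measurable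
    exact Measurable.aestronglyMeasurable (by fun_prop)
  · filter_upwards [eventually_ge_atTop 1] with l hl
    refine Eventually.of_forall fun y hy => ?_
    rw [uIoc_of_le zero_le_one] at hy
    have hlog := Real.log_nonpos hy.1.le hy.2
    have h1 : Real.log y ≤ Real.log y / l := by
      rw [le_div_iff₀ (by linarith)]
      nlinarith
    have h2 : Real.log y / l ≤ 0 := div_nonpos_of_nonpos_of_nonneg hlog (by linarith)
    rw [Real.norm_of_nonneg (mul_nonneg (weight_nonneg _ _ _) (by linarith))]
    calc _ ≤ 1 * (1 - Real.log y / l) := by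
          refine mul_le_mul_of_nonneg_right ?_ (by linarith)
          exact weight_le_one m (Real.one_le_exp (by linarith)) hy.1.le hy.2
      _ ≤ _ := by linarith
  · refine Eventually.of_forall fun y _ => ?_
    have h1 : Tendsto (fun l : ℝ => y / Real.exp (2 * l)) atTop (𝓝 0) :=
      tendsto_const_nhds.div_atTop
        (Real.tendsto_exp_atTop.comp (tendsto_id.const_mul_atTop two_pos))
    have h2 : Tendsto (fun l : ℝ => Real.log y / l) atTop (𝓝 0) :=
      tendsto_const_nhds.div_atTop tendsto_id
    have h3 := (((h1.const_sub 1).const_mul (1 - y)).sqrt.pow m).mul (h2.const_sub 1)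
    simpa [weight] using h3

theorem lintegral_weight_eq_logIntegral (m : ℕ) {l : ℝ} (hl : 0 < l) :
    ∫⁻ y in Ioo (0 : ℝ) 1, ENNReal.ofReal (weight m (Real.exp l ^ 2) y *
      (Real.log (Real.exp l ^ 2) - 2 * Real.log y)) = ENNReal.ofReal (2 * logIntegral m l) := by
  have h2 : Real.exp l ^ 2 = Real.exp (2 * l) := by rw [← Real.exp_nat_mul]; simp
  have hint := (intervalIntegrable_weight_mul m (Real.exp (2 * l)) l).const_mul 2
  rw [logIntegral, ← intervalIntegral.integral_const_mul,
    intervalIntegral.integral_of_le zero_le_one, integral_Ioc_eq_integral_Ioo,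
    ofReal_integral_eq_lintegral_ofReal]
  · rw [h2, Real.log_exp]
    refine lintegral_congr fun y => ?_
    congr 1
    ring
  · rw [intervalIntegrable_iff_integrableOn_Ioo_of_le zero_le_one] at hint
    exact hint
  · rw [EventuallyLE, ae_restrict_iff' measurableSet_Ioo]
    refine Eventually.of_forall fun y hy => ?_
    have hlog := Real.log_nonpos hy.1.le hy.2.le
    have := weight_nonneg m (Real.exp (2 * l)) y
    exact mul_nonneg two_pos.le (mul_nonneg this (by linarith))

/-! ### Closed form of `F`, its bound and its monotonicity -/

/-- The volume of the unit ball of `ℝ^d`. -/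
def unitBallVolume (d : ℕ) : ℝ := √Real.pi ^ d / Real.Gamma ((d : ℝ) / 2 + 1)

theorem unitBallVolume_pos (d : ℕ) : 0 < unitBallVolume d :=
  div_pos (pow_pos (Real.sqrt_pos.2 Real.pi_pos) d) (Real.Gamma_pos_of_pos (by positivity))

theorem volume_unitBall {d : ℕ} (hd : d ≠ 0) :
    volume (ball (0 : EuclideanSpace ℝ (Fin d)) 1) = ENNReal.ofReal (unitBallVolume d) := by
  have : Nonempty (Fin d) := ⟨⟨0, by omega⟩⟩
  rw [EuclideanSpace.volume_ball, unitBallVolume]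
  simp

theorem volUnitSphere_eq {n : ℕ} (hn : n ≠ 0) : volUnitSphere n = n * unitBallVolume n := by
  rw [volUnitSphere, Measure.toSphere_real_apply_univ, measureReal_def, volume_unitBall hn,
    ENNReal.toReal_ofReal (unitBallVolume_pos n).le]
  simp

/-- The constant factor of `F`. -/
def Fconst (m : ℕ) : ℝ :=
  2 * (m + 2) * unitBallVolume (m + 2) ^ 2 / ((m + 3) * unitBallVolume (m + 3))

theorem Fconst_pos (m : ℕ) : 0 < Fconst m := by
  have := unitBallVolume_pos (m + 2)
  have := unitBallVolume_pos (m + 3)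
  unfold Fconst
  positivity

/-- For `a = e^l`, the identity `a² - 1 = 2 e^l sinh l` turns `a^m / (a² - 1)^(m+1)` into `e^{-l} /
(2 sinh l)^(m+1)`. -/
theorem Omega_Q_exp (m : ℕ) {l : ℝ} (hl : 0 < l) :
    Omega (m + 3) (Q (m + 3) (Real.exp l)) =
      ENNReal.ofReal (2 * (m + 2) * unitBallVolume (m + 2) ^ 2 *
        (Real.exp (-l) * logIntegral m l / (2 * Real.sinh l) ^ (m + 1))) := by
  have hs := Real.sinh_pos_iff.2 hl
  have hV := unitBallVolume_pos (m + 2)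
  have hJ := logIntegral_pos m hl.le
  have hexp : Real.exp l ^ 2 - 1 = Real.exp l * (2 * Real.sinh l) := by
    rw [Real.sinh_eq, Real.exp_neg]
    field_simp
  rw [Omega_Q_eq_lintegral m (Real.one_lt_exp_iff.2 hl), lintegral_weight_eq_logIntegral m hl,
    hexp]
  have hball : volume (ball (0 : Boundary (m + 3)) 1) = ENNReal.ofReal (unitBallVolume (m + 2)) :=
    volume_unitBall (d := m + 2) (by omega)
  have hcast : (2 : ENNReal) * (m + 2) = ENNReal.ofReal (2 * (m + 2)) := by
    rw [ENNReal.ofReal_mul two_pos.le, ENNReal.ofReal_add m.cast_nonneg two_pos.le]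
    simp
  rw [hball, hcast, ← ENNReal.ofReal_pow hV.le, ← ENNReal.ofReal_mul (by positivity),
    ← ENNReal.ofReal_mul (by positivity), ← ENNReal.ofReal_mul (by positivity), Real.exp_neg]
  congr 1
  simp only [mul_pow]
  field_simp
  ring

theorem F_eq (m : ℕ) {l : ℝ} (hl : 0 < l) :
    F (m + 3) l = Fconst m * (Real.exp (-l) * logIntegral m l / (2 * Real.sinh l) ^ (m + 1)) := by
  have hs := Real.sinh_pos_iff.2 hl
  have hJ := logIntegral_pos m hl.le
  rw [F, measureReal_def, Omega_Q_exp m hl, ENNReal.toReal_ofReal (by positivity),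
    volUnitSphere_eq (by omega), Fconst]
  push_cast
  ring

theorem F_pos (m : ℕ) {l : ℝ} (hl : 0 < l) : 0 < F (m + 3) l := by
  have hs := Real.sinh_pos_iff.2 hl
  have hJ := logIntegral_pos m hl.le
  have := Fconst_pos m
  rw [F_eq m hl]
  positivity

/-- Two elementary bounds suffice: `e^{-l} J(l) ≤ e^{-l} (l + 1) ≤ 1` and `2 sinh l ≥ e^l - 1`. -/
theorem F_le (m : ℕ) {l : ℝ} (hl : 0 < l) :
    F (m + 3) l ≤ Fconst m / (Real.exp l - 1) ^ (m + 1) := by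
  have hs := Real.sinh_pos_iff.2 hl
  have hJ := logIntegral_pos m hl.le
  have he : 0 < Real.exp l - 1 := by linarith [Real.one_lt_exp_iff.2 hl]
  have h1 : Real.exp (-l) * logIntegral m l ≤ 1 := by
    rw [Real.exp_neg, inv_mul_le_one₀ (Real.exp_pos l)]
    exact (logIntegral_le m hl.le).trans (Real.add_one_le_exp l)
  have h2 : Real.exp l - 1 ≤ 2 * Real.sinh l := by
    have : Real.exp (-l) ≤ 1 := Real.exp_le_one_iff.2 (by linarith)
    rw [Real.sinh_eq]
    linarith
  rw [F_eq m hl, div_eq_mul_one_div (Fconst m)]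
  have := (Fconst_pos m).le
  gcongr

theorem continuousOn_F (m : ℕ) : ContinuousOn (F (m + 3)) (Ioi 0) := by
  have hJ : ContinuousOn (logIntegral m) (Ioi 0) :=
    (continuousOn_logIntegral m).mono Ioi_subset_Ici_self
  have h : ContinuousOn (fun l => Fconst m *
      (Real.exp (-l) * logIntegral m l / (2 * Real.sinh l) ^ (m + 1))) (Ioi 0) := by
    refine continuousOn_const.mul (ContinuousOn.div (by fun_prop) (by fun_prop) fun l hl => ?_)
    have hs := Real.sinh_pos_iff.2 hl
    positivity
  exact h.congr fun l hl => F_eq m hl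

/-- Strictness comes from the denominator alone; the numerator is only known to be antitone. -/
theorem strictAntiOn_F (m : ℕ) : StrictAntiOn (F (m + 3)) (Ioi 0) := by
  intro l₁ (h₁ : 0 < l₁) l₂ (h₂ : 0 < l₂) hlt
  rw [F_eq m h₁, F_eq m h₂]
  have hs := Real.sinh_pos_iff.2 h₁
  have hJ := logIntegral_pos m h₁.le
  have hsinh : Real.sinh l₁ < Real.sinh l₂ := Real.sinh_lt_sinh.2 hlt
  refine mul_lt_mul_of_pos_left ?_ (Fconst_pos m)
  refine div_lt_div₀' (antitoneOn_exp_neg_mul_logIntegral m h₁ h₂ hlt.le) ?_ (by positivity)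
    (by positivity)
  gcongr

/-! ### Evaluation of the constants and the two limits -/

theorem pi_rpow_half (k : ℕ) : Real.pi ^ ((k : ℝ) / 2) = √Real.pi ^ k := by
  rw [Real.sqrt_eq_rpow, ← Real.rpow_natCast, ← Real.rpow_mul Real.pi_pos.le]
  ring_nf

theorem Gamma_half_add (m : ℕ) : Real.Gamma (((m : ℝ) + 3) / 2 + 1) =
    (m + 3) / 2 * ((m + 1) / 2 * Real.Gamma (((m : ℝ) + 1) / 2)) := by
  rw [Real.Gamma_add_one (by positivity), show ((m : ℝ) + 3) / 2 = (m + 1) / 2 + 1 by ring,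
    Real.Gamma_add_one (by positivity)]

theorem Fconst_eq (m : ℕ) : Fconst m = ((m : ℝ) + 2) * (m + 1) * √Real.pi ^ (m + 1) *
    Real.Gamma (((m : ℝ) + 1) / 2) / (2 * Real.Gamma (((m : ℝ) + 4) / 2) ^ 2) := by
  have h1 : 0 < Real.Gamma (((m : ℝ) + 1) / 2) := Real.Gamma_pos_of_pos (by positivity)
  have h4 : 0 < Real.Gamma (((m : ℝ) + 4) / 2) := Real.Gamma_pos_of_pos (by positivity)
  have hp : 0 < √Real.pi := Real.sqrt_pos.2 Real.pi_pos
  rw [Fconst, unitBallVolume, unitBallVolume]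
  push_cast
  rw [Gamma_half_add, show ((m : ℝ) + 2) / 2 + 1 = (m + 4) / 2 by ring]
  field_simp
  ring

/-- Beyond the recursion `Γ(s + 1) = s Γ(s)`, the match needs Legendre's duplication formula at `(m
+ 1) / 2`, which accounts for the power of 2. -/
theorem K_eq (m : ℕ) :
    K (m + 3) = Fconst m * (P (m + 1) 1 / (m + 1) / 2 ^ (m + 1)) := by
  have h1 : 0 < Real.Gamma (((m : ℝ) + 1) / 2) := Real.Gamma_pos_of_pos (by positivity)
  have h2 : 0 < Real.Gamma (((m : ℝ) + 2) / 2) := Real.Gamma_pos_of_pos (by positivity)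
  have hm : 0 < Real.Gamma ((m : ℝ) + 1) := Real.Gamma_pos_of_pos (by positivity)
  have hp : 0 < √Real.pi := Real.sqrt_pos.2 Real.pi_pos
  have hdup : Real.Gamma (((m : ℝ) + 1) / 2) * Real.Gamma (((m : ℝ) + 2) / 2) * 2 ^ m =
      Real.Gamma ((m : ℝ) + 1) * √Real.pi := by
    have h := Real.Gamma_mul_Gamma_add_half (((m : ℝ) + 1) / 2)
    rw [show ((m : ℝ) + 1) / 2 + 1 / 2 = (m + 2) / 2 by ring,
      show 2 * (((m : ℝ) + 1) / 2) = m + 1 by ring, show (1 : ℝ) - (m + 1) = -m by ring,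
      Real.rpow_neg two_pos.le, Real.rpow_natCast] at h
    rw [h]
    field_simp
  have h4 : Real.Gamma (((m : ℝ) + 4) / 2) = (m + 2) / 2 * Real.Gamma (((m : ℝ) + 2) / 2) := by
    rw [show ((m : ℝ) + 4) / 2 = (m + 2) / 2 + 1 by ring, Real.Gamma_add_one (by positivity)]
  have hm2 : Real.Gamma ((m : ℝ) + 3 - 1) = (m + 1) * Real.Gamma ((m : ℝ) + 1) := by
    rw [show (m : ℝ) + 3 - 1 = m + 1 + 1 by ring, Real.Gamma_add_one (by positivity)]
  rw [Fconst_eq, K, show m + 3 - 2 = m + 1 by omega]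
  push_cast
  rw [show ((m : ℝ) + 3 - 3) / 2 = m / 2 by ring, pi_rpow_half, Gamma_half_add,
    show ((m : ℝ) + 3) / 2 - 1 = (m + 1) / 2 by ring, show (m : ℝ) + 3 + 1 = m + 4 by ring,
    hm2, h4]
  field_simp
  linear_combination 2 * √Real.pi ^ m * P (m + 1) 1 * hdup

theorem limit_const_eq (m : ℕ) :
    Fconst m * (2 / (m + 2)) = ((m : ℝ) + 1) * Real.pi ^ (((m : ℝ) + 1) / 2) *
      Real.Gamma (((m : ℝ) + 1) / 2) / Real.Gamma (((m : ℝ) + 4) / 2) ^ 2 := by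
  have h4 : 0 < Real.Gamma (((m : ℝ) + 4) / 2) := Real.Gamma_pos_of_pos (by positivity)
  have hp := pi_rpow_half (m + 1)
  push_cast at hp
  rw [Fconst_eq, hp]
  field_simp

theorem K_pos (m : ℕ) : 0 < K (m + 3) := by
  have := Fconst_pos m
  have h : 0 < P (m + 1) 1 := by
    rw [P_one_eq_sum_range]
    exact Finset.sum_pos (fun k _ => by positivity) ⟨0, by simp⟩
  rw [K_eq]
  positivity

theorem tendsto_div_sinh : Tendsto (fun l : ℝ => l / Real.sinh l) (𝓝[>] 0) (𝓝 1) := by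
  have h := hasDerivAt_iff_tendsto_slope.1 (Real.hasDerivAt_sinh 0)
  have h' := (h.mono_left (nhdsGT_le_nhdsNE 0)).inv₀ (by simp)
  simpa [slope_fun_def_field] using h'

theorem tendsto_F_zero (m : ℕ) :
    Tendsto (fun l : ℝ => l ^ (m + 1) * F (m + 3) l) (𝓝[>] 0) (𝓝 (K (m + 3))) := by
  have hJ : Tendsto (logIntegral m) (𝓝[>] 0) (𝓝 (logIntegral m 0)) :=
    ((continuousOn_logIntegral m) 0 self_mem_Ici).mono_left
      (nhdsWithin_mono 0 Ioi_subset_Ici_self)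
  have he : Tendsto (fun l : ℝ => Real.exp (-l)) (𝓝[>] 0) (𝓝 1) := by
    have : Continuous fun l : ℝ => Real.exp (-l) := by fun_prop
    simpa using (this.tendsto 0).mono_left nhdsWithin_le_nhds
  have h := ((he.mul hJ).mul ((tendsto_div_sinh.div_const 2).pow (m + 1))).const_mul (Fconst m)
  rw [K_eq]
  refine (h.congr' ?_).trans_eq ?_
  · filter_upwards [self_mem_nhdsWithin] with l (hl : 0 < l)
    have hs := Real.sinh_pos_iff.2 hl
    rw [F_eq m hl]
    simp only [mul_pow, div_pow]
    field_simp
  · rw [logIntegral_zero, one_mul, div_pow, one_pow, mul_one_div]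

theorem tendsto_exp_div_sinh :
    Tendsto (fun l : ℝ => Real.exp l / (2 * Real.sinh l)) atTop (𝓝 1) := by
  have h1 : Tendsto (fun l : ℝ => Real.exp (-(2 * l))) atTop (𝓝 0) :=
    Real.tendsto_exp_neg_atTop_nhds_zero.comp (tendsto_id.const_mul_atTop two_pos)
  have h2 := (h1.const_sub 1).inv₀ (by norm_num)
  rw [sub_zero, inv_one] at h2
  refine h2.congr fun l => ?_
  have : 2 * Real.sinh l = Real.exp l * (1 - Real.exp (-(2 * l))) := by
    rw [Real.sinh_eq, two_mul l, neg_add, Real.exp_add, Real.exp_neg]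
    field_simp
  rw [this, div_mul_eq_div_div, div_self (Real.exp_pos l).ne', one_div]

theorem tendsto_F_atTop (m : ℕ) :
    Tendsto (fun l : ℝ => Real.exp ((m + 2) * l) / l * F (m + 3) l) atTop
      (𝓝 (Fconst m * (2 / (m + 2)))) := by
  have h := ((tendsto_exp_div_sinh.pow (m + 1)).mul (tendsto_logIntegral_div m)).const_mul
    (Fconst m)
  rw [one_pow, one_mul] at h
  refine h.congr' ?_
  filter_upwards [eventually_gt_atTop 0] with l hl
  have hs := Real.sinh_pos_iff.2 hl
  -- The power `m + 1` pairs with the denominator `(2 sinh l)^(m+1)`; the last factor cancels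
  -- `e^{-l}`.
  have he : Real.exp ((m + 2) * l) = Real.exp l ^ (m + 1) * Real.exp l := by
    rw [← pow_succ, ← Real.exp_nat_mul]
    push_cast
    ring_nf
  rw [F_eq m hl, he, Real.exp_neg, div_pow]
  field_simp

end Asymptotics

end Orthospectrum

end

theorem mainTheorem4 (n : ℕ) (hn : 3 ≤ n) :
    -- `F_n` is a function from the positive reals to the positive reals
    (∀ l : ℝ, 0 < l →
      Orthospectrum.Omega n (Orthospectrum.Q n (Real.exp l)) < ⊤ ∧ 0 < Orthospectrum.F n l) ∧
    -- (1)
    (∃ C : ℝ, 0 < C ∧ ∀ l : ℝ, 0 < l →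
      Orthospectrum.F n l ≤ C / (Real.exp l - 1) ^ (n - 2)) ∧
    -- (2)
    ContinuousOn (Orthospectrum.F n) (Set.Ioi 0) ∧
    StrictAntiOn (Orthospectrum.F n) (Set.Ioi 0) ∧
    -- (3)
    0 < Orthospectrum.K n ∧
    Filter.Tendsto (fun l : ℝ => l ^ (n - 2) * Orthospectrum.F n l)
      (nhdsWithin 0 (Set.Ioi 0)) (nhds (Orthospectrum.K n)) ∧
    -- (4)
    Filter.Tendsto
      (fun l : ℝ => Real.exp (((n : ℝ) - 1) * l) / l * Orthospectrum.F n l) Filter.atTop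
      (nhds (((n : ℝ) - 2) * Real.pi ^ (((n : ℝ) - 2) / 2) * Real.Gamma ((n : ℝ) / 2 - 1)
        / Real.Gamma (((n : ℝ) + 1) / 2) ^ 2)) := by
  -- With `m = n - 3` as parameter, the weight exponent `m / 2`, the boundary dimension `m + 2` and
  -- the power `m + 1` involve no truncated subtraction.
  obtain ⟨m, rfl⟩ : ∃ m, n = m + 3 := ⟨n - 3, by omega⟩
  have h2 : m + 3 - 2 = m + 1 := by omega
  rw [h2]
  refine ⟨fun l hl => ⟨?_, Orthospectrum.F_pos m hl⟩,
    ⟨_, Orthospectrum.Fconst_pos m, fun l hl => Orthospectrum.F_le m hl⟩,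
    Orthospectrum.continuousOn_F m, Orthospectrum.strictAntiOn_F m, Orthospectrum.K_pos m,
    Orthospectrum.tendsto_F_zero m, ?_⟩
  · rw [Orthospectrum.Omega_Q_exp m hl]
    exact ENNReal.ofReal_lt_top
  · have h := Orthospectrum.tendsto_F_atTop m
    rw [Orthospectrum.limit_const_eq] at h
    have e1 : ((m + 3 : ℕ) : ℝ) - 1 = m + 2 := by push_cast; ring
    have e2 : ((m + 3 : ℕ) : ℝ) - 2 = m + 1 := by push_cast; ring
    have e3 : ((m + 3 : ℕ) : ℝ) / 2 - 1 = (m + 1) / 2 := by push_cast; ring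
    have e4 : ((m + 3 : ℕ) : ℝ) + 1 = m + 4 := by push_cast; ring
    rw [e1, e2, e3, e4]
    exact h
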